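/- Let $X$ be a complex Banach space and let $T$ be a bounded linear operator on $X$ with relatively weakly compact orbits, i.e. for every $y\in X$ the set $\{T^ny : n=0,1,2,\dots\}$ is relatively compact in the weak topology of $X$. Suppose that $T$ has no eigenvalue of modulus $1$, and let $x\in X$. Let $f$ be a function of class $P_1$, that is, a continuous real function on some interval $[t_0,\infty)$ such that, for all sufficiently large $t$, $f$ is continuously differentiable with $f(t)>0$ and $f'(t)>0$, and such that $$\limsup_{t\to\infty}\frac{f(t)}{t\,f'(t)}<\infty,\qquad \limsup_{t\to\infty}\ \sup_{s\ge t}\frac{f'(s)}{f'(t)}<\infty .$$ Let $(h_n)_{n\ge1}$ be a bounded sequence of integers, and let $A\subset\mathbb N=\{1,2,\dots\}$ be a set of positive density, i.e. the limit $\lim_{n\to\infty}\frac{|A\cap[1,n]|}{n}$ exists and is positive. Denote by $[\cdot]$ the integer part, and put $T^{[f(n)]+h_n}:=I$ for those (finitely many) $n$ for which $f(n)$ is undefined or the exponent is negative. Then $$\lim_{N\to\infty}\ \sup_{x^*\in X^*,\ \|x^*\|=1}\ \frac1{|A\cap[1,N]|}\sum_{n\in A\cap[1,N]}\bigl|\langle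 T^{[f(n)]+h_n}x,x^*\rangle\bigr|=0 .$$ In particular, $$\lim_{N\to\infty}\ \frac1{|A\cap[1,N]|}\sum_{n\in A\cap[1,N]}T^{[f(n)]+h_n}x=0$$ in the norm of $X$. -/

import Mathlib

open Filter Topology

noncomputable section

namespace SubseqErgodic

/-- The class `P_m`. It is a property of the germ of `f` at `+∞`: all conditions concern only
large arguments. Both upper limits and the supremum are taken in the extended reals, so `< ⊤`
is genuine finiteness. -/
def IsClassP (m : ℕ) (f : ℝ → ℝ) : Prop :=
  1 ≤ m ∧
  (∃ t₁ : ℝ, ContDiffOn ℝ m f (Set.Ioi t₁)) ∧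
  (∀ j ≤ m, ∀ᶠ t : ℝ in atTop, 0 < iteratedDeriv j f t) ∧
  limsup (fun t : ℝ => ((iteratedDeriv (m - 1) f t / (t * iteratedDeriv m f t) : ℝ) : EReal))
    atTop < ⊤ ∧
  limsup (fun t : ℝ => ⨆ s ≥ t, ((iteratedDeriv m f s / iteratedDeriv m f t : ℝ) : EReal))
    atTop < ⊤

open Classical in
/-- The finite set `A ∩ [1, N]`. -/
def upTo (A : Set ℕ) (N : ℕ) : Finset ℕ := (Finset.Icc 1 N).filter (· ∈ A)

/-- `A` has density `d`. -/
def HasDensity (A : Set ℕ) (d : ℝ) : Prop :=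
  Tendsto (fun n : ℕ => ((upTo A n).card : ℝ) / (n : ℝ)) atTop (𝓝 d)

/-- `A` has a density, and this density is positive. -/
def HasPositiveDensity (A : Set ℕ) : Prop := ∃ d : ℝ, 0 < d ∧ HasDensity A d

variable {X : Type*} [NormedAddCommGroup X] [NormedSpace ℂ X]

/-- Every orbit `{T ^ n x : n = 0, 1, 2, …}` is relatively compact in the weak topology of `X`. -/
def RelWeaklyCompactOrbits (T : X →L[ℂ] X) : Prop :=
  ∀ x : X, IsCompact (closure (toWeakSpace ℂ X '' Set.range (fun n : ℕ => (T ^ n) x)))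

/-- The operator `T ^ ([f(n)] + h_n)`, where `f` is regarded as a function with domain `[t₀, ∞)`;
by convention it is the identity operator if the exponent is negative or undefined. -/
def powerAlong (T : X →L[ℂ] X) (t₀ : ℝ) (f : ℝ → ℝ) (h : ℕ → ℤ) (n : ℕ) : X →L[ℂ] X :=
  if t₀ ≤ (n : ℝ) ∧ 0 ≤ ⌊f n⌋ + h n then T ^ (⌊f n⌋ + h n).toNat else 1

/-- The average of `|⟨T ^ ([f(n)] + h_n) x, φ⟩|` over `n ∈ A ∩ [1, N]`. -/
def absAverage (T : X →L[ℂ] X) (t₀ : ℝ) (f : ℝ → ℝ) (h : ℕ → ℤ) (A : Set ℕ) (x : X) (N : ℕ)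
    (φ : X →L[ℂ] ℂ) : ℝ :=
  ((upTo A N).card : ℝ)⁻¹ * ∑ n ∈ upTo A N, ‖φ (powerAlong T t₀ f h n x)‖

/-- The average of `T ^ ([f(n)] + h_n) x` over `n ∈ A ∩ [1, N]`. -/
def average (T : X →L[ℂ] X) (t₀ : ℝ) (f : ℝ → ℝ) (h : ℕ → ℤ) (A : Set ℕ) (x : X) (N : ℕ) : X :=
  ((upTo A N).card : ℂ)⁻¹ • ∑ n ∈ upTo A N, powerAlong T t₀ f h n x

end SubseqErgodic

end

/-! Everything reduces to the plain averages of `|φ (T ^ n x)|`, uniformly for `φ` in the dual unit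
ball (`uniform_average_small`). If these fail to vanish, bad functionals yield points of a compact
shift-invariant space of scalar sequences `n ↦ φ (T ^ n x)`, and Krylov–Bogoliubov gives an
invariant measure for which the zeroth coordinate is nonzero in `L²`. Weak compactness of the orbit
makes the coordinates a totally bounded orbit of the Koopman isometry, so that orbit correlates with
a unimodular eigenvector (`exists_eigenvector_of_totallyBounded_orbit`). But for `‖c‖ = 1` the
operator `c⁻¹ • T` fixes no nonzero vector, so the averages of `c⁻¹ ^ n` times the coordinates tend
to zero pointwise (`tendsto_weak_average`), which destroys the correlation.

To pass to the exponents `⌊f n⌋ + h n`, count multiplicities. Each value occurs `O(1 + 1 / f' N)`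
times for `n ≤ N` (`card_floor_near_le`), and the values are `O(f N)`. Since `f N` and `f N / f' N`
are both `O(N)`, the sum remains `o(N)`. Restricting to `A` costs only the reciprocal of a lower
bound for its density. -/

open Filter Topology

noncomputable section

namespace SubseqErgodic

/-! ### Eigenvectors of a Hilbert space isometry from a totally bounded orbit. -/

section Hilbert

variable {H : Type*} [NormedAddCommGroup H] [InnerProductSpace ℂ H]

open InnerProductSpace

/-- The average of the rank-one operators attached to `v, U v, …, U ^ k v`. -/
def correlationAverage (U : H →ₗᵢ[ℂ] H) (v : H) (k : ℕ) : H →L[ℂ] H :=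
  ((k + 1 : ℕ) : ℝ)⁻¹ • ∑ n ∈ Finset.range (k + 1), rankOne ℂ ((U ^ n) v) ((U ^ n) v)

lemma correlationAverage_apply (U : H →ₗᵢ[ℂ] H) (v : H) (k : ℕ) (a : H) :
    correlationAverage U v k a = ((k + 1 : ℕ) : ℝ)⁻¹ •
      ∑ n ∈ Finset.range (k + 1), inner ℂ ((U ^ n) v) a • (U ^ n) v := by
  simp [correlationAverage]

lemma norm_pow_isometry_apply (U : H →ₗᵢ[ℂ] H) (n : ℕ) (v : H) : ‖(U ^ n) v‖ = ‖v‖ :=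
  (U ^ n).norm_map v

lemma isCompactOperator_correlationAverage (U : H →ₗᵢ[ℂ] H) (v : H) (k : ℕ) :
    IsCompactOperator (correlationAverage U v k) := by
  have h1 : ∀ y : H, rankOne ℂ y y ∈ compactOperator (RingHom.id ℂ) H H := by
    intro y
    change IsCompactOperator (rankOne ℂ y y)
    rw [rankOne_def']
    have := isCompactOperator_of_locallyCompactSpace_rng
      (ContinuousLinearMap.toSpanSingleton ℂ y)
    exact this.comp_clm (innerSL ℂ y)
  have h2 : (((k + 1 : ℕ) : ℝ)⁻¹ • ∑ n ∈ Finset.range (k + 1),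
      rankOne ℂ ((U ^ n) v) ((U ^ n) v) : H →L[ℂ] H) ∈ compactOperator (RingHom.id ℂ) H H := by
    have : (((k + 1 : ℕ) : ℝ)⁻¹ • ∑ n ∈ Finset.range (k + 1),
      rankOne ℂ ((U ^ n) v) ((U ^ n) v) : H →L[ℂ] H) = (((((k + 1 : ℕ) : ℝ)⁻¹ : ℝ)) : ℂ) •
        ∑ n ∈ Finset.range (k + 1), rankOne ℂ ((U ^ n) v) ((U ^ n) v) := by
      rw [Complex.coe_smul]
    rw [this]
    exact Submodule.smul_mem _ _ (Submodule.sum_mem _ fun n _ => h1 _)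
  exact h2

/-- The map from `y` to its rank-one operator is norm continuous, so the averages lie in the closed
convex hull of a compact set. Norm convergence is what keeps the limit a compact operator. -/
lemma exists_tendsto_correlationAverage [CompleteSpace H] (U : H →ₗᵢ[ℂ] H) (v : H)
    (htb : TotallyBounded (Set.range fun n : ℕ => (U ^ n) v)) :
    ∃ C : H →L[ℂ] H, ∃ k : ℕ → ℕ, StrictMono k ∧
      Tendsto (fun j => correlationAverage U v (k j)) atTop (𝓝 C) := by
  have hc : IsCompact (closure (Set.range fun n : ℕ => (U ^ n) v)) :=
    htb.closure.isCompact_of_isClosed isClosed_closure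
  have hcont : Continuous fun y : H => rankOne ℂ y y :=
    ((ContinuousLinearMap.smulRightL ℂ H H).continuous.comp (innerSL ℂ).continuous).clm_apply
      continuous_id
  have hK := (hc.image hcont).totallyBounded
  have hK2 := (totallyBounded_convexHull.2 hK).closure.isCompact_of_isClosed isClosed_closure
  have hmem : ∀ k, correlationAverage U v k ∈
      closure (convexHull ℝ ((fun y : H => rankOne ℂ y y) ''
        closure (Set.range fun n : ℕ => (U ^ n) v))) := by
    intro k
    apply subset_closure
    have := Finset.centerMass_mem_convexHull (R := ℝ) (Finset.range (k + 1))
      (w := fun _ => (1 : ℝ)) (z := fun n => rankOne ℂ ((U ^ n) v) ((U ^ n) v))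
      (s := (fun y : H => rankOne ℂ y y) '' closure (Set.range fun n : ℕ => (U ^ n) v))
      (fun _ _ => zero_le_one) (by simp; positivity)
      (fun n _ => ⟨_, subset_closure ⟨n, rfl⟩, rfl⟩)
    simpa [Finset.centerMass, correlationAverage] using this
  obtain ⟨C, -, k, hk, hC⟩ := hK2.tendsto_subseq hmem
  exact ⟨C, k, hk, hC⟩

/-- The two sums differ by an index shift, so only the boundary terms survive; the limit operator
therefore commutes with `U`. -/
lemma isometry_comp_correlationAverage_sub (U : H →ₗᵢ[ℂ] H) (v : H) (k : ℕ) (a : H) :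
    ‖U (correlationAverage U v k a) - correlationAverage U v k (U a)‖ ≤
      ((k + 1 : ℕ) : ℝ)⁻¹ * (2 * ‖v‖ ^ 2 * ‖a‖) := by
  have hsucc : ∀ n, U ((U ^ n) v) = (U ^ (n + 1)) v := fun n => by rw [pow_succ']; rfl
  have key : U (correlationAverage U v k a) - correlationAverage U v k (U a) =
      ((k + 1 : ℕ) : ℝ)⁻¹ • (inner ℂ ((U ^ k) v) a • (U ^ (k + 1)) v - inner ℂ v (U a) • v) := by
    rw [correlationAverage_apply, correlationAverage_apply, ← Complex.coe_smul, map_smul,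
      Complex.coe_smul, ← smul_sub, map_sum]
    congr 1
    rw [Finset.sum_range_succ, Finset.sum_range_succ']
    have : ∀ n, inner ℂ ((U ^ (n + 1)) v) (U a) = inner ℂ ((U ^ n) v) a := fun n => by
      rw [← hsucc, U.inner_map_map]
    simp only [map_smul, hsucc, this, pow_zero, LinearIsometry.coe_one, id]
    abel
  rw [key, norm_smul, Real.norm_of_nonneg (by positivity)]
  refine mul_le_mul_of_nonneg_left ?_ (by positivity)
  refine (norm_sub_le _ _).trans ?_
  rw [norm_smul, norm_smul, norm_pow_isometry_apply]
  have h1 := norm_inner_le_norm (𝕜 := ℂ) ((U ^ k) v) a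
  have h2 := norm_inner_le_norm (𝕜 := ℂ) v (U a)
  rw [norm_pow_isometry_apply] at h1
  rw [U.norm_map] at h2
  nlinarith [norm_nonneg v]

/-- A limit `C` of correlation averages is compact, symmetric, nonzero and commutes with `U`. A
nonzero eigenvalue of `C` has a finite-dimensional `U`-invariant eigenspace, where `U` has an
eigenvector. -/
lemma exists_eigenvector_of_totallyBounded_orbit [CompleteSpace H] (U : H →ₗᵢ[ℂ] H) {v : H}
    (hv : v ≠ 0) (htb : TotallyBounded (Set.range fun n : ℕ => (U ^ n) v)) :
    ∃ c : ℂ, ‖c‖ = 1 ∧ ∃ e : H, U e = c • e ∧ inner ℂ e v ≠ 0 := by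
  obtain ⟨C, k, hk, hC⟩ := exists_tendsto_correlationAverage U v htb
  have hCa : ∀ a, Tendsto (fun j => correlationAverage U v (k j) a) atTop (𝓝 (C a)) := fun a =>
    ((ContinuousLinearMap.apply ℂ H a).continuous.tendsto C).comp hC
  have hcpt : IsCompactOperator C :=
    isCompactOperator_of_tendsto hC
      (Eventually.of_forall fun j => isCompactOperator_correlationAverage U v (k j))
  have hsymm : (C : H →ₗ[ℂ] H).IsSymmetric := by
    intro a b
    refine tendsto_nhds_unique ((hCa a).inner (tendsto_const_nhds (x := b)))
      (((tendsto_const_nhds (x := a)).inner (hCa b)).congr fun j => ?_)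
    simp only [correlationAverage_apply]
    rw [← Complex.coe_smul, ← Complex.coe_smul, inner_smul_left, inner_smul_right, sum_inner,
      inner_sum, Complex.conj_ofReal]
    congr 1
    refine Finset.sum_congr rfl fun n _ => ?_
    rw [inner_smul_left, inner_smul_right, inner_conj_symm]
    ring
  have hcomm : ∀ a, U (C a) = C (U a) := by
    intro a
    have h1 := ((U.continuous.tendsto _).comp (hCa a)).sub (hCa (U a))
    have h2 : Tendsto (fun j => U (correlationAverage U v (k j) a) -
        correlationAverage U v (k j) (U a)) atTop (𝓝 0) := by
      refine squeeze_zero_norm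
        (fun j => isometry_comp_correlationAverage_sub U v (k j) a) ?_
      have h3 : Tendsto (fun j => ((k j + 1 : ℕ) : ℝ)⁻¹) atTop (𝓝 0) :=
        tendsto_inv_atTop_zero.comp (tendsto_natCast_atTop_atTop.comp
          ((tendsto_add_atTop_nat 1).comp hk.tendsto_atTop))
      simpa using h3.mul_const (2 * ‖v‖ ^ 2 * ‖a‖)
    exact sub_eq_zero.1 (tendsto_nhds_unique h1 h2)
  -- Each orbit point is within `‖v‖ / 2` of some `g` in a finite net, so its inner product with `g`
  -- is at least `‖v‖ ^ 2 / 2`. Hence the sum of `⟨g, C g⟩` over the net cannot vanish.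
  have hne : C ≠ 0 := by
    rintro rfl
    have hvpos : 0 < ‖v‖ := norm_pos_iff.2 hv
    obtain ⟨t, ht, hcov⟩ := Metric.totallyBounded_iff.1 htb (‖v‖ / 2) (by positivity)
    have hlow : ∀ n, ‖v‖ ^ 4 / 4 ≤ ∑ g ∈ ht.toFinset, ‖inner ℂ ((U ^ n) v) g‖ ^ 2 := by
      intro n
      have hx := hcov ⟨n, rfl⟩
      simp only [Set.mem_iUnion, Metric.mem_ball, dist_eq_norm, exists_prop] at hx
      obtain ⟨g, hg, hlt⟩ := hx
      refine le_trans ?_ (Finset.single_le_sum (f := fun g => ‖inner ℂ ((U ^ n) v) g‖ ^ 2)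
        (fun _ _ => sq_nonneg _) (ht.mem_toFinset.2 hg))
      have h1 : inner ℂ ((U ^ n) v) g =
          (‖v‖ ^ 2 : ℝ) - inner ℂ ((U ^ n) v) ((U ^ n) v - g) := by
        rw [inner_sub_right, inner_self_eq_norm_sq_to_K, norm_pow_isometry_apply]
        simp
      have h2 := norm_inner_le_norm (𝕜 := ℂ) ((U ^ n) v) ((U ^ n) v - g)
      rw [norm_pow_isometry_apply] at h2
      have h3 : ‖v‖ ^ 2 / 2 ≤ ‖inner ℂ ((U ^ n) v) g‖ := by
        rw [h1]
        have := norm_sub_norm_le ((‖v‖ ^ 2 : ℝ) : ℂ) (inner ℂ ((U ^ n) v) ((U ^ n) v - g))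
        rw [Complex.norm_real, Real.norm_of_nonneg (by positivity)] at this
        nlinarith
      calc ‖v‖ ^ 4 / 4 = (‖v‖ ^ 2 / 2) ^ 2 := by ring
        _ ≤ _ := by gcongr
    have hlim : Tendsto (fun j => ∑ g ∈ ht.toFinset,
        (inner ℂ g (correlationAverage U v (k j) g)).re) atTop (𝓝 0) := by
      have : Tendsto (fun j => ∑ g ∈ ht.toFinset,
          (inner ℂ g (correlationAverage U v (k j) g)).re) atTop
          (𝓝 (∑ g ∈ ht.toFinset, (inner ℂ g ((0 : H →L[ℂ] H) g)).re)) :=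
        tendsto_finsetSum _ fun g _ => (Complex.continuous_re.tendsto _).comp
          ((tendsto_const_nhds (x := g)).inner (hCa g))
      simpa using this
    have hge : ∀ j, ‖v‖ ^ 4 / 4 ≤ ∑ g ∈ ht.toFinset,
        (inner ℂ g (correlationAverage U v (k j) g)).re := by
      intro j
      have h1 : ∀ g, (inner ℂ g (correlationAverage U v (k j) g)).re =
          ((k j + 1 : ℕ) : ℝ)⁻¹ * ∑ n ∈ Finset.range (k j + 1), ‖inner ℂ ((U ^ n) v) g‖ ^ 2 := by
        intro g
        rw [correlationAverage_apply, ← Complex.coe_smul, inner_smul_right, inner_sum,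
          Complex.re_ofReal_mul, Complex.re_sum]
        congr 1
        refine Finset.sum_congr rfl fun n _ => ?_
        rw [inner_smul_right, ← inner_conj_symm g, Complex.mul_conj, Complex.ofReal_re,
          Complex.normSq_eq_norm_sq]
      simp only [h1]
      rw [← Finset.mul_sum, Finset.sum_comm, inv_mul_eq_div, le_div_iff₀ (by positivity)]
      calc ‖v‖ ^ 4 / 4 * ((k j + 1 : ℕ) : ℝ)
          = ∑ n ∈ Finset.range (k j + 1), ‖v‖ ^ 4 / 4 := by simp; ring
        _ ≤ _ := Finset.sum_le_sum fun n _ => hlow n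
    have := ge_of_tendsto' hlim hge
    have : 0 < ‖v‖ ^ 4 / 4 := by positivity
    linarith
  obtain ⟨κ, hκ, hκ0⟩ : ∃ κ, Module.End.HasEigenvalue (C : Module.End ℂ H) κ ∧ κ ≠ 0 := by
    by_contra! hcon
    exact hne ((ContinuousLinearMap.eq_zero_of_forall_hasEigenvalue_eq_zero hcpt hsymm).1 hcon)
  have hfin := ContinuousLinearMap.finite_dimensional_eigenspace hcpt κ hκ0
  have hmaps : ∀ a ∈ Module.End.eigenspace (C : Module.End ℂ H) κ,
      (U : H →ₗ[ℂ] H) a ∈ Module.End.eigenspace (C : Module.End ℂ H) κ := by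
    intro a ha
    rw [Module.End.mem_eigenspace_iff] at ha ⊢
    change C (U a) = κ • U a
    rw [← hcomm, ← map_smul]
    exact congrArg U ha
  have : Nontrivial (Module.End.eigenspace (C : Module.End ℂ H) κ) :=
    (Submodule.nontrivial_iff_ne_bot).2 hκ
  obtain ⟨c, hc⟩ := Module.End.exists_eigenvalue ((U : H →ₗ[ℂ] H).restrict hmaps)
  obtain ⟨e, he, he0⟩ := hc.exists_hasEigenvector
  have hUe : U e = c • (e : H) := by
    have := congrArg Subtype.val (Module.End.mem_eigenspace_iff.1 he)
    simpa using this
  have he0' : (e : H) ≠ 0 := by simpa using he0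
  have hcn : ‖c‖ = 1 := by
    have := congrArg norm hUe
    rw [U.norm_map, norm_smul] at this
    have h2 : 0 < ‖(e : H)‖ := norm_pos_iff.2 he0'
    nlinarith
  refine ⟨c, hcn, e, hUe, fun h0 => ?_⟩
  have hUn : ∀ n, (U ^ n) (e : H) = c ^ n • (e : H) := by
    intro n
    induction n with
    | zero => simp
    | succ n ih =>
      rw [pow_succ', pow_succ]
      change U ((U ^ n) (e : H)) = _
      rw [ih, map_smul, hUe, smul_smul]
  -- Orthogonality to `v` would spread along the orbit and force `C e = 0`, against `κ ≠ 0`.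
  have horth : ∀ n, inner ℂ ((U ^ n) v) (e : H) = 0 := by
    intro n
    have h1 := (U ^ n).inner_map_map v e
    rw [hUn, inner_smul_right, ← inner_conj_symm v, h0, map_zero] at h1
    have : c ^ n ≠ 0 := pow_ne_zero _ (by rintro rfl; simp at hcn)
    exact (mul_eq_zero.1 h1).resolve_left this
  have hCe : C e = 0 := by
    refine tendsto_nhds_unique (hCa e) (tendsto_const_nhds.congr fun j => ?_)
    simp [correlationAverage_apply, horth]
  have hCe' : C e = κ • (e : H) := Module.End.mem_eigenspace_iff.1 e.2
  rw [hCe] at hCe'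
  exact (smul_ne_zero hκ0 he0') hCe'.symm

end Hilbert

/-! ### Invariant measures from orbit averages. -/

section InvariantMeasure

open MeasureTheory

open scoped BoundedContinuousFunction

/-- **Krylov–Bogoliubov**: a continuous self-map of a compact space has an invariant probability
measure for which the integral of `F` is at least the lower bound of given orbit averages. -/
lemma exists_invariant_probability {Q : Type*} [TopologicalSpace Q] [CompactSpace Q] [T2Space Q]
    [MeasurableSpace Q] [BorelSpace Q] {S : Q → Q} (hS : Continuous S) (q : ℕ → Q) (N : ℕ → ℕ)
    (hN : ∀ j, j < N j) {F : Q → ℝ} (hF : Continuous F) {ε : ℝ}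
    (h : ∀ j, ε * N j ≤ ∑ n ∈ Finset.range (N j), F (S^[n] (q j))) :
    ∃ μ : Measure Q, IsProbabilityMeasure μ ∧
      (∀ g : Q → ℝ, Continuous g → ∫ a, g (S a) ∂μ = ∫ a, g a ∂μ) ∧ ε ≤ ∫ a, F a ∂μ := by
  have hN0 : ∀ j, (N j : ENNReal) ≠ 0 := fun j => by
    have := hN j
    exact_mod_cast (by omega : N j ≠ 0)
  have hNpos : ∀ j, (0 : ℝ) < N j := fun j => by
    have := hN j
    exact_mod_cast (by omega : 0 < N j)
  let m : ℕ → Measure Q := fun j =>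
    (N j : ENNReal)⁻¹ • ∑ n ∈ Finset.range (N j), Measure.dirac (S^[n] (q j))
  have hm : ∀ j, IsProbabilityMeasure (m j) := fun j => ⟨by
    simp [m, Measure.smul_apply, ENNReal.inv_mul_cancel (hN0 j) (ENNReal.natCast_ne_top _)]⟩
  have hint : ∀ j (g : Q → ℝ), ∫ a, g a ∂(m j) =
      (N j : ℝ)⁻¹ * ∑ n ∈ Finset.range (N j), g (S^[n] (q j)) := by
    intro j g
    simp only [m]
    rw [integral_smul_measure, integral_finsetSum_measure fun n _ => integrable_dirac (by simp)]
    simp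
  let p : ℕ → ProbabilityMeasure Q := fun j => ⟨m j, hm j⟩
  -- An ultrafilter limit is used because `Q` need not be metrizable.
  obtain ⟨μ, -, hμ⟩ := isCompact_univ.ultrafilter_le_nhds
    ((hyperfilter ℕ).map p) (by simp)
  have hlim : ∀ g : Q → ℝ, Continuous g →
      Tendsto (fun j => (N j : ℝ)⁻¹ * ∑ n ∈ Finset.range (N j), g (S^[n] (q j)))
        (hyperfilter ℕ) (𝓝 (∫ a, g a ∂(μ : Measure Q))) := by
    intro g hg
    have h1 : Tendsto p (hyperfilter ℕ) (𝓝 μ) := hμ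
    have h2 := ProbabilityMeasure.tendsto_iff_forall_integral_tendsto.1 h1
      (BoundedContinuousFunction.mkOfCompact ⟨g, hg⟩)
    refine h2.congr fun j => ?_
    exact hint j g
  refine ⟨μ, inferInstance, fun g hg => ?_, ?_⟩
  · have h1 := (hlim _ (hg.comp hS)).sub (hlim g hg)
    refine sub_eq_zero.1 (tendsto_nhds_unique h1 ?_)
    obtain ⟨B, hB⟩ := (isCompact_range hg).isBounded.exists_norm_le
    have hNtop : Tendsto (fun j => (N j : ℝ)) atTop atTop :=
      tendsto_natCast_atTop_atTop.comp (tendsto_atTop_mono (fun j => (hN j).le) tendsto_id)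
    have h2 : Tendsto (fun j => (N j : ℝ)⁻¹ * (2 * B)) (hyperfilter ℕ) (𝓝 0) := by
      have := (tendsto_inv_atTop_zero.comp hNtop).mul_const (2 * B)
      rw [zero_mul] at this
      exact this.mono_left Nat.hyperfilter_le_atTop
    refine squeeze_zero_norm (fun j => ?_) h2
    rw [← mul_sub, ← Finset.sum_sub_distrib, norm_mul, Real.norm_of_nonneg (by positivity)]
    refine mul_le_mul_of_nonneg_left ?_ (by positivity)
    simp only [Function.comp_apply, ← Function.iterate_succ_apply' S]
    rw [Finset.sum_range_sub (fun n => g (S^[n] (q j)))]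
    refine (norm_sub_le _ _).trans ?_
    have h3 := hB _ ⟨S^[N j] (q j), rfl⟩
    have h4 := hB _ ⟨S^[0] (q j), rfl⟩
    linarith
  · refine ge_of_tendsto' (hlim F hF) fun j => ?_
    rw [inv_mul_eq_div, le_div_iff₀ (hNpos j)]
    exact h j

end InvariantMeasure

/-! ### Sequential compactness of weakly compact orbit closures. -/

section WeakCompactness

variable {X : Type*} [NormedAddCommGroup X] [NormedSpace ℂ X]

lemma continuous_weakSpace_eval (φ : X →L[ℂ] ℂ) :
    Continuous fun w : WeakSpace ℂ X => φ ((toWeakSpace ℂ X).symm w) :=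
  WeakBilin.eval_continuous (topDualPairing ℂ X).flip φ

/-- By Mazur, the norm-closed linear span is already weakly closed. -/
lemma exists_separable_of_mem_weakClosure_range (u : ℕ → X) :
    ∃ Y : Submodule ℂ X, TopologicalSpace.IsSeparable (Y : Set X) ∧
      ∀ w ∈ closure (toWeakSpace ℂ X '' Set.range u), (toWeakSpace ℂ X).symm w ∈ Y := by
  refine ⟨(Submodule.span ℂ (Set.range u)).topologicalClosure, ?_, fun w hw => ?_⟩
  · rw [Submodule.topologicalClosure_coe]
    exact ((Set.countable_range u).isSeparable.span (R := ℂ)).closure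
  · have hconv : Convex ℝ (Submodule.span ℂ (Set.range u) : Set X) :=
      ((Submodule.span ℂ (Set.range u)).restrictScalars ℝ).convex
    have h1 := closure_mono (Set.image_mono (f := toWeakSpace ℂ X)
      (Submodule.subset_span (R := ℂ) (s := Set.range u))) hw
    have h2 := hconv.toWeakSpace_closure (𝕜 := ℂ)
    rw [← h2] at h1
    obtain ⟨y, hy, rfl⟩ := h1
    rw [← SetLike.mem_coe, Submodule.topologicalClosure_coe]
    simpa using hy

/-- A sequence with relatively weakly compact range has a weakly convergent subsequence. -/
lemma exists_subseq_weakly_tendsto {u : ℕ → X}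
    (hK : IsCompact (closure (toWeakSpace ℂ X '' Set.range u))) (n : ℕ → ℕ) :
    ∃ k : ℕ → ℕ, StrictMono k ∧ ∃ z : X, ∀ φ : X →L[ℂ] ℂ,
      Tendsto (fun j => φ (u (n (k j)))) atTop (𝓝 (φ z)) := by
  obtain ⟨Y, hYsep, hY⟩ := exists_separable_of_mem_weakClosure_range u
  have : TopologicalSpace.SeparableSpace Y := hYsep.separableSpace
  set K := closure (toWeakSpace ℂ X '' Set.range u) with hKdef
  have : CompactSpace K := isCompact_iff_compactSpace.1 hK
  choose ψ hψ1 hψ2 using fun i => exists_dual_vector'' ℂ (TopologicalSpace.denseSeq Y i : X)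
  -- Norming functionals of a dense sequence in `Y` separate `K`: if `ψ i` kills `d` and the `i`-th
  -- term is within `‖d‖ / 4` of `d`, that term has norm below `‖d‖ / 4`, which is absurd.
  have : TopologicalSpace.MetrizableSpace K := by
    refine Metric.PiNatEmbed.TopologicalSpace.MetrizableSpace.of_countable_separating
      (fun i (w : K) => ψ i ((toWeakSpace ℂ X).symm w))
      (fun i => (continuous_weakSpace_eval (ψ i)).comp continuous_subtype_val) fun a b hab => ?_
    set d : Y := ⟨_, hY a a.2⟩ - ⟨_, hY b b.2⟩ with hd
    have hd0 : (d : X) ≠ 0 := by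
      have : (toWeakSpace ℂ X).symm a ≠ (toWeakSpace ℂ X).symm b :=
        (toWeakSpace ℂ X).symm.injective.ne (Subtype.val_injective.ne hab)
      simpa [hd, sub_eq_zero] using this
    have hdpos : 0 < ‖(d : X)‖ := norm_pos_iff.2 hd0
    obtain ⟨i, hi⟩ := (TopologicalSpace.denseRange_denseSeq Y).exists_dist_lt d
      (half_pos (half_pos hdpos))
    refine ⟨i, fun heq => ?_⟩
    have h0 : ψ i (d : X) = 0 := by
      have : (d : X) = (toWeakSpace ℂ X).symm a - (toWeakSpace ℂ X).symm b := rfl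
      rw [this, map_sub, sub_eq_zero]
      exact heq
    have h1 : ‖(d : X) - TopologicalSpace.denseSeq Y i‖ < ‖(d : X)‖ / 2 / 2 := by
      rw [dist_eq_norm] at hi
      exact hi
    have h2 : ‖(TopologicalSpace.denseSeq Y i : X)‖ ≤
        ‖(d : X) - TopologicalSpace.denseSeq Y i‖ := by
      have h3 := (ψ i).le_of_opNorm_le (hψ1 i) ((d : X) - TopologicalSpace.denseSeq Y i)
      rw [map_sub, h0, zero_sub, norm_neg, hψ2, one_mul] at h3
      simpa using h3
    have h4 := norm_sub_norm_le (d : X) (TopologicalSpace.denseSeq Y i)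
    linarith
  let s : ℕ → K := fun j => ⟨toWeakSpace ℂ X (u (n j)), subset_closure ⟨_, ⟨_, rfl⟩, rfl⟩⟩
  obtain ⟨z, k, hk, hz⟩ := CompactSpace.tendsto_subseq s
  refine ⟨k, hk, (toWeakSpace ℂ X).symm z, fun φ => ?_⟩
  exact (((continuous_weakSpace_eval φ).comp continuous_subtype_val).tendsto z).comp hz

end WeakCompactness

/-! ### Weak mean ergodic theorem without fixed vectors. -/

section WeakMeanErgodic

open MeasureTheory

variable {X : Type*} [NormedAddCommGroup X] [NormedSpace ℂ X]

lemma isClosed_weakSpace_preimage_closedBall (y : X) (r : ℝ) :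
    IsClosed {w : WeakSpace ℂ X | (toWeakSpace ℂ X).symm w ∈ Metric.closedBall y r} := by
  have h := (convex_closedBall y r).toWeakSpace_closure (𝕜 := ℂ)
  rw [Metric.isClosed_closedBall.closure_eq] at h
  have h2 : {w : WeakSpace ℂ X | (toWeakSpace ℂ X).symm w ∈ Metric.closedBall y r} =
      toWeakSpace ℂ X '' Metric.closedBall y r := by
    ext w
    exact ⟨fun hw => ⟨_, hw, (toWeakSpace ℂ X).apply_symm_apply w⟩, by rintro ⟨a, ha, rfl⟩; simpa using ha⟩
  rw [h2, h]
  exact isClosed_closure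

/-- A norm separable set with its weak Borel structure is included in the space in a strongly
measurable way. -/
lemma stronglyMeasurable_weakSpace_inclusion {K : Set (WeakSpace ℂ X)} [MeasurableSpace K]
    [OpensMeasurableSpace K] {Y : Submodule ℂ X} (hYsep : TopologicalSpace.IsSeparable (Y : Set X))
    (hY : ∀ w ∈ K, (toWeakSpace ℂ X).symm w ∈ Y) :
    StronglyMeasurable fun w : K => (toWeakSpace ℂ X).symm (w : WeakSpace ℂ X) := by
  borelize X
  have : TopologicalSpace.SeparableSpace Y := hYsep.separableSpace
  refine stronglyMeasurable_iff_measurable_separable.2 ⟨?_, ?_⟩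
  · refine measurable_of_isOpen fun O hO => ?_
    -- A norm-open set is covered, inside `Y`, by countably many closed balls, and these are weakly
    -- closed.
    have hcover : (fun w : K => (toWeakSpace ℂ X).symm (w : WeakSpace ℂ X)) ⁻¹' O =
        ⋃ p ∈ {p : ℕ × ℕ | Metric.closedBall (TopologicalSpace.denseSeq Y p.1 : X)
          (1 / ((p.2 : ℝ) + 1)) ⊆ O}, {w : K | (toWeakSpace ℂ X).symm (w : WeakSpace ℂ X) ∈
            Metric.closedBall (TopologicalSpace.denseSeq Y p.1 : X) (1 / ((p.2 : ℝ) + 1))} := by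
      ext w
      simp only [Set.mem_preimage, Set.mem_ofPred_eq, Set.mem_iUnion, exists_prop]
      refine ⟨fun hw => ?_, fun ⟨p, hp, hwp⟩ => hp hwp⟩
      obtain ⟨ε, hε, hball⟩ := Metric.isOpen_iff.1 hO _ hw
      obtain ⟨m, hm⟩ := exists_nat_one_div_lt (half_pos hε)
      obtain ⟨i, hi⟩ := (TopologicalSpace.denseRange_denseSeq Y).exists_dist_lt
        (⟨_, hY w w.2⟩ : Y) (Nat.one_div_pos_of_nat (α := ℝ) (n := m))
      have hi' : dist ((toWeakSpace ℂ X).symm (w : WeakSpace ℂ X))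
          (TopologicalSpace.denseSeq Y i : X) < 1 / ((m : ℝ) + 1) := hi
      refine ⟨(i, m), fun b hb => hball ?_, hi'.le⟩
      rw [Metric.mem_closedBall] at hb
      rw [Metric.mem_ball]
      rw [dist_comm] at hi'
      linarith [dist_triangle b (TopologicalSpace.denseSeq Y i : X)
        ((toWeakSpace ℂ X).symm (w : WeakSpace ℂ X))]
    rw [hcover]
    exact MeasurableSet.biUnion (Set.to_countable _) fun p _ =>
      ((isClosed_weakSpace_preimage_closedBall _ _).preimage continuous_subtype_val).measurableSet
  · exact hYsep.mono (by rintro _ ⟨w, rfl⟩; exact hY w w.2)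

lemma exists_norm_le_of_isCompact_weakSpace {K : Set (WeakSpace ℂ X)} (hK : IsCompact K) :
    ∃ B, ∀ w ∈ K, ‖(toWeakSpace ℂ X).symm w‖ ≤ B := by
  obtain ⟨B, hB⟩ := banach_steinhaus (g := fun w : K =>
      NormedSpace.inclusionInDoubleDual ℂ X ((toWeakSpace ℂ X).symm (w : WeakSpace ℂ X))) fun φ => by
    obtain ⟨B, hB⟩ := (hK.image (continuous_weakSpace_eval φ)).isBounded.exists_norm_le
    exact ⟨B, fun w => hB _ ⟨w, w.2, rfl⟩⟩
  refine ⟨B, fun w hw => ?_⟩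
  rw [← (NormedSpace.inclusionInDoubleDualLi ℂ (E := X)).norm_map]
  exact hB ⟨w, hw⟩

lemma exists_norm_pow_le [CompleteSpace X] {T : X →L[ℂ] X} (hT : RelWeaklyCompactOrbits T) :
    ∃ M, ∀ n : ℕ, ‖T ^ n‖ ≤ M := by
  refine banach_steinhaus fun y => ?_
  obtain ⟨B, hB⟩ := exists_norm_le_of_isCompact_weakSpace (hT y)
  exact ⟨B, fun n => by
    simpa using hB (toWeakSpace ℂ X ((T ^ n) y)) (subset_closure ⟨_, ⟨n, rfl⟩, rfl⟩)⟩

/-- Otherwise the weak orbit closure carries an invariant probability measure with `∫ Re φ ≥ ε`. Its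
barycentre is fixed by `T`, hence zero, so the integral is zero. -/
lemma re_average_lt_of_no_fixed_vector [CompleteSpace X] {T : X →L[ℂ] X} {x : X}
    (hK : IsCompact (closure (toWeakSpace ℂ X '' Set.range fun n : ℕ => (T ^ n) x)))
    (hfix : ∀ y, T y = y → y = 0) (φ : X →L[ℂ] ℂ) {ε : ℝ} (hε : 0 < ε) :
    ∀ᶠ N : ℕ in atTop, ∑ n ∈ Finset.range N, (φ ((T ^ n) x)).re < ε * N := by
  by_contra hcon
  rw [not_eventually, frequently_atTop] at hcon
  choose N hN hge using fun j => hcon (j + 1)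
  obtain ⟨Y, hYsep, hY⟩ := exists_separable_of_mem_weakClosure_range fun n : ℕ => (T ^ n) x
  obtain ⟨B, hB⟩ := exists_norm_le_of_isCompact_weakSpace hK
  set K := closure (toWeakSpace ℂ X '' Set.range fun n : ℕ => (T ^ n) x) with hKdef
  have : CompactSpace K := isCompact_iff_compactSpace.1 hK
  let _ : MeasurableSpace K := borel K
  have : BorelSpace K := ⟨rfl⟩
  have hmaps : Set.MapsTo (WeakSpace.map T) K K := by
    refine Set.MapsTo.closure ?_ (WeakSpace.map T).continuous
    rintro _ ⟨_, ⟨n, rfl⟩, rfl⟩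
    exact ⟨_, ⟨n + 1, rfl⟩, by simp only [pow_succ']; rfl⟩
  have hcont : Continuous (hmaps.restrict _ _ _) :=
    (WeakSpace.map T).continuous.continuousOn.mapsToRestrict hmaps
  let q : K := ⟨toWeakSpace ℂ X x, subset_closure ⟨_, ⟨0, rfl⟩, rfl⟩⟩
  have hiter : ∀ n, (toWeakSpace ℂ X).symm ((hmaps.restrict _ _ _)^[n] q : WeakSpace ℂ X) =
      (T ^ n) x := by
    intro n
    induction n with
    | zero => simp [q]
    | succ n ih =>
      rw [Function.iterate_succ_apply', pow_succ', mul_apply_eq_comp, ← ih]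
      rfl
  have hev : ∀ ψ : X →L[ℂ] ℂ, Continuous fun w : K =>
      (ψ ((toWeakSpace ℂ X).symm (w : WeakSpace ℂ X))).re := fun ψ =>
    Complex.continuous_re.comp ((continuous_weakSpace_eval ψ).comp continuous_subtype_val)
  obtain ⟨μ, hμ, hinv, hint⟩ := exists_invariant_probability hcont (fun _ => q) N
    (fun j => hN j) (hev φ) (ε := ε) fun j => by
      simp only [hiter]
      exact not_lt.1 (hge j)
  have hι : Integrable (fun w : K => (toWeakSpace ℂ X).symm (w : WeakSpace ℂ X)) μ :=
    Integrable.of_bound (stronglyMeasurable_weakSpace_inclusion hYsep hY).aestronglyMeasurable B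
      (Eventually.of_forall fun w => hB w w.2)
  have hre : ∀ ψ : X →L[ℂ] ℂ, ∫ w : K, (ψ ((toWeakSpace ℂ X).symm (w : WeakSpace ℂ X))).re ∂μ =
      (ψ (∫ w : K, (toWeakSpace ℂ X).symm (w : WeakSpace ℂ X) ∂μ)).re := by
    intro ψ
    rw [← ψ.integral_comp_comm hι]
    exact integral_re (ψ.integrable_comp hι)
  have hy : T (∫ w : K, (toWeakSpace ℂ X).symm (w : WeakSpace ℂ X) ∂μ) =
      ∫ w : K, (toWeakSpace ℂ X).symm (w : WeakSpace ℂ X) ∂μ := by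
    have hr : ∀ ψ : X →L[ℂ] ℂ, (ψ (T (∫ w : K, (toWeakSpace ℂ X).symm (w : WeakSpace ℂ X) ∂μ))).re =
        (ψ (∫ w : K, (toWeakSpace ℂ X).symm (w : WeakSpace ℂ X) ∂μ)).re := by
      intro ψ
      rw [← hre ψ, ← hinv _ (hev ψ)]
      exact (hre (ψ.comp T)).symm
    refine (SeparatingDual.eq_iff_forall_dual_eq (R := ℂ)).2 fun ψ => Complex.ext (hr ψ) ?_
    have := hr (Complex.I • ψ)
    simpa using this
  rw [hre, hfix _ hy] at hint
  simp only [map_zero, Complex.zero_re] at hint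
  linarith

/-- If `T` has no fixed vector, the ergodic averages along a relatively weakly compact orbit
converge weakly to `0`. -/
lemma tendsto_weak_average [CompleteSpace X] {T : X →L[ℂ] X} {x : X}
    (hK : IsCompact (closure (toWeakSpace ℂ X '' Set.range fun n : ℕ => (T ^ n) x)))
    (hfix : ∀ y, T y = y → y = 0) (φ : X →L[ℂ] ℂ) :
    Tendsto (fun N : ℕ => (N : ℂ)⁻¹ * ∑ n ∈ Finset.range N, φ ((T ^ n) x)) atTop (𝓝 0) := by
  rw [Metric.tendsto_nhds]
  intro ε hε
  have h2 : 0 < ε / 2 := by positivity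
  filter_upwards [re_average_lt_of_no_fixed_vector hK hfix φ h2,
    re_average_lt_of_no_fixed_vector hK hfix (-φ) h2,
    re_average_lt_of_no_fixed_vector hK hfix (Complex.I • φ) h2,
    re_average_lt_of_no_fixed_vector hK hfix (-(Complex.I • φ)) h2, eventually_gt_atTop 0]
    with N h1 h2 h3 h4 hN
  have hNpos : (0 : ℝ) < N := by exact_mod_cast hN
  simp only [_root_.neg_apply, _root_.smul_apply, smul_eq_mul,
    Complex.neg_re, Complex.I_mul_re, Finset.sum_neg_distrib, neg_neg] at h1 h2 h3 h4
  rw [dist_zero_right, norm_mul, norm_inv, Complex.norm_natCast, inv_mul_eq_div, div_lt_iff₀ hNpos]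
  refine (Complex.norm_le_abs_re_add_abs_im _).trans_lt ?_
  rw [Complex.re_sum, Complex.im_sum]
  have h5 := abs_lt.2 ⟨neg_lt.1 h2, h1⟩
  have h6 := abs_lt.2 ⟨neg_lt.1 h3, h4⟩
  linarith

/-- The rotated orbit lies in the image of circle × orbit closure under scalar multiplication, which
is jointly continuous for the weak topology. -/
lemma isCompact_weakClosure_smul_orbit {T : X →L[ℂ] X} {x : X}
    (hK : IsCompact (closure (toWeakSpace ℂ X '' Set.range fun n : ℕ => (T ^ n) x)))
    {c : ℂ} (hc : ‖c‖ = 1) :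
    IsCompact (closure (toWeakSpace ℂ X '' Set.range fun n : ℕ => ((c • T) ^ n) x)) := by
  have h1 := ((isCompact_sphere (0 : ℂ) 1).prod hK).image
    (continuous_smul (M := ℂ) (X := WeakSpace ℂ X))
  refine h1.of_isClosed_subset isClosed_closure (closure_minimal ?_ h1.isClosed)
  rintro _ ⟨_, ⟨n, rfl⟩, rfl⟩
  refine ⟨(c ^ n, toWeakSpace ℂ X ((T ^ n) x)), ⟨by simp [hc], subset_closure ⟨_, ⟨n, rfl⟩, rfl⟩⟩, ?_⟩
  simp [smul_pow]

end WeakMeanErgodic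

/-! ### Uniform averages of scalar orbits. -/

section UniformAverage

open MeasureTheory

/-- Without a finite net one picks a separated sequence of values, none of whose subsequences is
Cauchy. -/
lemma totallyBounded_range_of_subseq_tendsto {E : Type*} [UniformSpace E] {w : ℕ → E}
    (h : ∀ n : ℕ → ℕ, ∃ k : ℕ → ℕ, StrictMono k ∧ ∃ l, Tendsto (fun j => w (n (k j))) atTop (𝓝 l)) :
    TotallyBounded (Set.range w) := by
  intro V hV
  by_contra! hcon
  obtain ⟨u, hu⟩ : ∃ u : ℕ → E, (∀ n, u n ∈ Set.range w) ∧
      ∀ n m, m < n → u m ∉ UniformSpace.ball (u n) V := by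
    simp only [Set.not_subset, Set.mem_iUnion₂, not_exists, exists_prop] at hcon
    simpa only [forall_and, Set.forall_mem_image, not_and] using! Set.seq_of_forall_finite_exists hcon
  choose n hn using hu.1
  obtain ⟨k, hk, l, hl⟩ := h n
  simp only [hn] at hl
  obtain ⟨N, hN⟩ : ∃ N, ∀ p q, p ≥ N → q ≥ N → (u (k p), u (k q)) ∈ V := hl.cauchySeq.mem_entourage hV
  exact hu.2 _ _ (hk (Nat.lt_add_one N)) (hN (N + 1) N N.le_succ le_rfl)

section L2

variable {Q : Type*} [TopologicalSpace Q] [CompactSpace Q] [MeasurableSpace Q] [BorelSpace Q] {μ : Measure Q} [IsFiniteMeasure μ]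

/-- Bounded convergence in `L²` for continuous functions. -/
lemma exists_tendsto_toLp_of_tendsto {f : ℕ → C(Q, ℂ)} {B : ℝ} (hB : ∀ j a, ‖f j a‖ ≤ B)
    {g : Q → ℂ} (hfg : ∀ a, Tendsto (fun j => f j a) atTop (𝓝 (g a))) :
    ∃ hg : MemLp g 2 μ,
      Tendsto (fun j => ContinuousMap.toLp 2 μ ℂ (f j)) atTop (𝓝 (hg.toLp g)) := by
  have hmeas : AEStronglyMeasurable g μ := aestronglyMeasurable_of_tendsto_ae atTop
    (fun j => (f j).continuous.aestronglyMeasurable) (Eventually.of_forall hfg)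
  have hg : MemLp g 2 μ := MemLp.of_bound hmeas B (Eventually.of_forall fun a =>
    le_of_tendsto' (hfg a).norm fun j => hB j a)
  refine ⟨hg, ?_⟩
  have hui : UnifIntegrable (fun j a => f j a) 2 μ := by
    refine unifIntegrable_of (by norm_num) (by norm_num)
      (fun j => (f j).continuous.aestronglyMeasurable) fun ε hε => ⟨(B + 1).toNNReal, fun j => ?_⟩
    have : {a | (B + 1).toNNReal ≤ ‖f j a‖₊} = ∅ := by
      refine Set.eq_empty_iff_forall_notMem.2 fun a ha => ?_
      have h1 : (B + 1).toNNReal ≤ ‖f j a‖₊ := ha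
      rw [Real.toNNReal_le_iff_le_coe, coe_nnnorm] at h1
      linarith [hB j a]
    rw [this]
    simp
  have h1 := tendsto_Lp_finite_of_tendsto_ae (p := 2) (by norm_num) (by norm_num)
    (fun j => (f j).continuous.aestronglyMeasurable) hg hui (Eventually.of_forall hfg)
  refine Lp.tendsto_Lp_of_tendsto_eLpNorm g hg (h1.congr fun j => eLpNorm_congr_ae ?_)
  filter_upwards [ContinuousMap.coeFn_toLp (p := 2) (𝕜 := ℂ) μ (f j)] with a ha
  rw [Pi.sub_apply, Pi.sub_apply, ha]

lemma compMeasurePreserving_toLp {S : Q → Q} (hS : MeasurePreserving S μ μ) (hSc : Continuous S)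
    (f : C(Q, ℂ)) :
    Lp.compMeasurePreservingₗᵢ ℂ S hS (ContinuousMap.toLp 2 μ ℂ f) =
      ContinuousMap.toLp 2 μ ℂ (f.comp ⟨S, hSc⟩) := by
  refine Lp.ext ?_
  refine (Lp.coeFn_compMeasurePreserving _ hS).trans ?_
  refine EventuallyEq.trans ?_ (ContinuousMap.coeFn_toLp μ _).symm
  exact hS.quasiMeasurePreserving.ae_eq_comp (ContinuousMap.coeFn_toLp μ f)

end L2

variable {X : Type*} [NormedAddCommGroup X] [NormedSpace ℂ X]

/-- The set of scalar orbits `n ↦ φ (T ^ n x)` of functionals bounded by `M` along all powers. -/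
def scalarOrbits (T : X →L[ℂ] X) (x : X) (M : ℝ) : Set (ℕ → ℂ) :=
  (fun (φ : WeakDual ℂ X) (n : ℕ) => φ ((T ^ n) x)) ''
    {φ | ∀ (n : ℕ) (y : X), ‖φ ((T ^ n) y)‖ ≤ M * ‖y‖}

lemma isCompact_scalarOrbits (T : X →L[ℂ] X) (x : X) {M : ℝ} (hM : 0 ≤ M) :
    IsCompact (scalarOrbits T x M) := by
  refine IsCompact.image ?_ (continuous_pi fun n => WeakDual.eval_continuous _)
  refine (WeakDual.isCompact_closedBall (𝕜 := ℂ) (E := X) 0 M).of_isClosed_subset ?_ fun φ hφ => ?_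
  · simp only [Set.ofPred_forall]
    exact isClosed_iInter fun n => isClosed_iInter fun y =>
      isClosed_le (WeakDual.eval_continuous _).norm continuous_const
  · rw [Set.mem_preimage, mem_closedBall_zero_iff]
    exact ContinuousLinearMap.opNorm_le_bound _ hM fun y => by simpa using hφ 0 y

/-- The shift is realised by `φ ↦ φ ∘ T`, and bounding `φ` along all powers is stable under this. -/
lemma mapsTo_shift_scalarOrbits (T : X →L[ℂ] X) (x : X) (M : ℝ) :
    Set.MapsTo (fun (a : ℕ → ℂ) n => a (n + 1)) (scalarOrbits T x M) (scalarOrbits T x M) := by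
  rintro _ ⟨φ, hφ, rfl⟩
  have h : ∀ (n : ℕ) (y : X), T ((T ^ n) y) = (T ^ (n + 1)) y := fun n y => by
    rw [pow_succ']; rfl
  refine ⟨StrongDual.toWeakDual ((WeakDual.toStrongDual φ).comp T), fun n y => ?_, ?_⟩
  · have := hφ (n + 1) y
    rw [← h] at this
    exact this
  · funext n
    change φ (T ((T ^ n) x)) = _
    rw [h]

/-- If `T` has relatively weakly compact orbits and no eigenvalue of modulus `1`, the averages of
`|φ (T ^ n x)|` tend to `0`, uniformly for `φ` in the dual unit ball. -/
theorem uniform_average_small [CompleteSpace X] {T : X →L[ℂ] X}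
    {M : ℝ} (hM : ∀ n : ℕ, ‖T ^ n‖ ≤ M)
    (hσ : ∀ c : ℂ, ‖c‖ = 1 → ¬ Module.End.HasEigenvalue (T : X →ₗ[ℂ] X) c) {x : X}
    (hK : IsCompact (closure (toWeakSpace ℂ X '' Set.range fun n : ℕ => (T ^ n) x)))
    {ε : ℝ} (hε : 0 < ε) :
    ∃ N₀, ∀ N ≥ N₀, ∀ φ : X →L[ℂ] ℂ, ‖φ‖ ≤ 1 →
      ∑ n ∈ Finset.range N, ‖φ ((T ^ n) x)‖ ≤ ε * N := by
  by_contra! hcon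
  choose N hN φ hφ hlt using fun j => hcon (j + 1)
  have hM0 : 0 ≤ M := (norm_nonneg _).trans (hM 0)
  set Q := scalarOrbits T x M with hQ
  have : CompactSpace Q := isCompact_iff_compactSpace.1 (isCompact_scalarOrbits T x hM0)
  have hmaps := mapsTo_shift_scalarOrbits T x M
  have hSc : Continuous (hmaps.restrict _ _ _) :=
    (Continuous.continuousOn (by fun_prop)).mapsToRestrict hmaps
  set S : Q → Q := hmaps.restrict _ _ _ with hSdef
  have hcoord : ∀ n, Continuous fun a : Q => (a : ℕ → ℂ) n := fun n =>
    (continuous_apply n).comp continuous_subtype_val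
  let coord : ℕ → C(Q, ℂ) := fun n => ⟨fun a => (a : ℕ → ℂ) n, hcoord n⟩
  have hiter : ∀ n m (a : Q), (S^[n] a : ℕ → ℂ) m = (a : ℕ → ℂ) (m + n) := by
    intro n
    induction n with
    | zero => intro m a; rfl
    | succ n ih =>
      intro m a
      rw [Function.iterate_succ_apply, ih]
      change (a : ℕ → ℂ) (m + n + 1) = _
      rw [add_assoc]
  have hbound : ∀ n (a : Q), ‖(a : ℕ → ℂ) n‖ ≤ M * ‖x‖ := by
    rintro n ⟨_, ψ, hψ, rfl⟩
    exact hψ n x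
  let q : ℕ → Q := fun j => ⟨fun n => φ j ((T ^ n) x), StrongDual.toWeakDual (φ j), fun n y => by
    refine ((φ j).le_of_opNorm_le (hφ j) _).trans ?_
    rw [one_mul]
    exact (T ^ n).le_of_opNorm_le (hM n) y, rfl⟩
  obtain ⟨μ, hμ, hinv, hint⟩ := exists_invariant_probability hSc q N (fun j => hN j)
    (F := fun a => ‖(a : ℕ → ℂ) 0‖) (hcoord 0).norm (ε := ε) fun j => by
      simp only [hiter, zero_add]
      exact (hlt j).le
  have hS : MeasurePreserving S μ μ := by
    refine ⟨hSc.measurable, ?_⟩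
    have : IsFiniteMeasure (μ.map S) := inferInstance
    refine ext_of_forall_integral_eq_of_IsFiniteMeasure fun g => ?_
    rw [integral_map hSc.measurable.aemeasurable g.continuous.aestronglyMeasurable]
    exact hinv g g.continuous
  set U : Lp ℂ 2 μ →ₗᵢ[ℂ] Lp ℂ 2 μ := Lp.compMeasurePreservingₗᵢ ℂ S hS with hU
  set v : ℕ → Lp ℂ 2 μ := fun n => ContinuousMap.toLp 2 μ ℂ (coord n) with hv
  have hUv : ∀ n, U (v n) = v (n + 1) := fun n => compMeasurePreserving_toLp hS hSc (coord n)
  have hUpow : ∀ n, (U ^ n) (v 0) = v n := by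
    intro n
    induction n with
    | zero => rfl
    | succ n ih =>
      rw [pow_succ']
      change U ((U ^ n) (v 0)) = _
      rw [ih, hUv]
  have hv0 : v 0 ≠ 0 := by
    intro h0
    have h1 := ContinuousMap.coeFn_toLp (p := 2) (𝕜 := ℂ) μ (coord 0)
    have h2 : (v 0 : Q → ℂ) =ᵐ[μ] 0 := by rw [h0]; exact Lp.coeFn_zero _ _ _
    have h3 : ∫ a : Q, ‖(a : ℕ → ℂ) 0‖ ∂μ = ∫ a : Q, (0 : ℝ) ∂μ := by
      refine integral_congr_ae ?_
      filter_upwards [h1, h2] with a ha1 ha2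
      have : (a : ℕ → ℂ) 0 = 0 := by
        change coord 0 a = 0
        rw [← ha1]
        exact ha2
      simp [this]
    rw [h3, integral_zero] at hint
    linarith
  -- A weakly convergent subsequence of `T ^ n x` makes the coordinates converge at every point of
  -- `Q`, hence in `L²` by boundedness.
  have htb : TotallyBounded (Set.range fun n : ℕ => (U ^ n) (v 0)) := by
    simp only [hUpow]
    refine totallyBounded_range_of_subseq_tendsto fun n => ?_
    obtain ⟨k, hk, z, hz⟩ := exists_subseq_weakly_tendsto hK n
    have hlim : ∀ a : Q, ∃ l, Tendsto (fun j => coord (n (k j)) a) atTop (𝓝 l) := by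
      rintro ⟨_, ψ, hψ, rfl⟩
      exact ⟨ψ z, hz (WeakDual.toStrongDual ψ)⟩
    choose g hg using hlim
    obtain ⟨h, hl⟩ := exists_tendsto_toLp_of_tendsto (μ := μ) (f := fun j => coord (n (k j)))
      (fun j a => hbound _ a) hg
    exact ⟨k, hk, _, hl⟩
  obtain ⟨c, hc, e, hUe, hev⟩ := exists_eigenvector_of_totallyBounded_orbit U hv0 htb
  have hc0 : c ≠ 0 := by rintro rfl; simp at hc
  have hinner : ∀ n, inner ℂ e (v n) = c ^ n * inner ℂ e (v 0) := by
    intro n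
    induction n with
    | zero => simp
    | succ n ih =>
      have h1 := U.inner_map_map e (v n)
      rw [hUe, hUv, inner_smul_left, ih] at h1
      have h2 : c * (starRingEnd ℂ) c = 1 := by
        rw [Complex.mul_conj, Complex.normSq_eq_norm_sq, hc]
        simp
      calc inner ℂ e (v (n + 1)) = c * ((starRingEnd ℂ) c * inner ℂ e (v (n + 1))) := by
            rw [← mul_assoc, h2, one_mul]
        _ = c ^ (n + 1) * inner ℂ e (v 0) := by rw [h1]; ring
  have hfix : ∀ y, (c⁻¹ • T) y = y → y = 0 := by
    intro y hy
    by_contra hy0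
    refine hσ c hc (Module.End.hasEigenvalue_of_hasEigenvector (x := y)
      ⟨Module.End.mem_eigenspace_iff.2 ?_, hy0⟩)
    change T y = c • y
    nth_rewrite 2 [← hy]
    rw [_root_.smul_apply, smul_inv_smul₀ hc0]
  have hK' := isCompact_weakClosure_smul_orbit hK (c := c⁻¹) (by simp [hc])
  -- These twisted averages tend to zero in `L²`, yet each with `m > 0` has the same nonzero inner
  -- product with `e`.
  let b : ℕ → C(Q, ℂ) := fun m => (m : ℂ)⁻¹ • ∑ n ∈ Finset.range m, (c⁻¹) ^ n • coord n
  have hbB : ∀ m (a : Q), ‖b m a‖ ≤ M * ‖x‖ := by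
    intro m a
    have h1 : b m a = (m : ℂ)⁻¹ * ∑ n ∈ Finset.range m, (c⁻¹) ^ n * (a : ℕ → ℂ) n := by
      simp [b, coord]
    have h2 : ‖∑ n ∈ Finset.range m, (c⁻¹) ^ n * (a : ℕ → ℂ) n‖ ≤ m * (M * ‖x‖) := by
      refine (norm_sum_le _ _).trans ?_
      calc ∑ n ∈ Finset.range m, ‖(c⁻¹) ^ n * (a : ℕ → ℂ) n‖
          ≤ ∑ n ∈ Finset.range m, M * ‖x‖ := Finset.sum_le_sum fun n _ => by
            simpa [hc] using hbound n a
        _ = m * (M * ‖x‖) := by simp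
    rw [h1, norm_mul, norm_inv, Complex.norm_natCast]
    rcases Nat.eq_zero_or_pos m with rfl | hm
    · simp; positivity
    · have hm' : (0 : ℝ) < m := by exact_mod_cast hm
      rwa [inv_mul_eq_div, div_le_iff₀ hm', mul_comm]
  have hb0 : ∀ a : Q, Tendsto (fun m => b m a) atTop (𝓝 0) := by
    rintro ⟨_, ψ, hψ, rfl⟩
    refine (tendsto_weak_average hK' hfix (WeakDual.toStrongDual ψ)).congr fun m => ?_
    simp only [b, coord, ContinuousMap.smul_apply, ContinuousMap.sum_apply, smul_eq_mul,
      ContinuousMap.coe_mk, smul_pow, _root_.smul_apply, map_smul]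
    rfl
  obtain ⟨hg, hlim⟩ := exists_tendsto_toLp_of_tendsto (μ := μ) hbB hb0
  have hlim2 := (tendsto_const_nhds (x := e)).inner hlim (𝕜 := ℂ)
  have hzero : hg.toLp (fun _ : Q => (0 : ℂ)) = 0 := MemLp.toLp_zero hg
  rw [hzero, inner_zero_right] at hlim2
  refine hev (tendsto_nhds_unique (tendsto_const_nhds.congr' ?_) hlim2)
  filter_upwards [eventually_gt_atTop 0] with m hm
  have hm' : (m : ℂ) ≠ 0 := by exact_mod_cast hm.ne'
  have : ContinuousMap.toLp 2 μ ℂ (b m) =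
      (m : ℂ)⁻¹ • ∑ n ∈ Finset.range m, (c⁻¹) ^ n • v n := by
    simp only [b, map_smul, map_sum, hv]
  rw [this, inner_smul_right, inner_sum]
  have hterm : ∀ n, inner ℂ e ((c⁻¹) ^ n • v n) = inner ℂ e (v 0) := fun n => by
    rw [inner_smul_right, hinner, inv_pow, inv_mul_cancel_left₀ (pow_ne_zero _ hc0)]
  rw [Finset.sum_congr rfl fun n _ => hterm n, Finset.sum_const, Finset.card_range, nsmul_eq_mul, inv_mul_cancel_left₀ hm']

end UniformAverage

/-! ### Growth of `f` and multiplicity of the exponents. -/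

section Counting

lemma eventually_le_of_limsup_lt_top {g : ℝ → EReal} (h : limsup g atTop < ⊤) :
    ∃ C : ℝ, ∀ᶠ t in atTop, g t ≤ (C : EReal) := by
  obtain ⟨C, hC, -⟩ := EReal.lt_iff_exists_real_btwn.1 h
  exact ⟨C, (eventually_lt_of_limsup_lt hC).mono fun t ht => ht.le⟩

lemma IsClassP.exists_bounds {f : ℝ → ℝ} (hf : IsClassP 1 f) :
    ∃ C t₁ : ℝ, 0 < C ∧ 1 ≤ t₁ ∧ ∀ t ≥ t₁, 0 < f t ∧ 0 < deriv f t ∧ f t ≤ C * t * deriv f t ∧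
      ∀ s ≥ t, deriv f s ≤ C * deriv f t := by
  obtain ⟨-, -, hpos, h1, h2⟩ := hf
  obtain ⟨C₁, hC₁⟩ := eventually_le_of_limsup_lt_top h1
  obtain ⟨C₂, hC₂⟩ := eventually_le_of_limsup_lt_top h2
  have hf0 := hpos 0 (by norm_num)
  have hf1 := hpos 1 le_rfl
  simp only [iteratedDeriv_zero, iteratedDeriv_one, Nat.sub_self] at *
  obtain ⟨t₁, ht₁⟩ := eventually_atTop.1 ((hf0.and hf1).and (hC₁.and hC₂))
  refine ⟨max (max C₁ C₂) 1, max t₁ 1, by positivity, le_max_right _ _, fun t ht => ?_⟩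
  obtain ⟨⟨ha, hb⟩, hc, hd⟩ := ht₁ t ((le_max_left _ _).trans ht)
  have htpos : 0 < t := lt_of_lt_of_le one_pos ((le_max_right _ _).trans ht)
  refine ⟨ha, hb, ?_, fun s hs => ?_⟩
  · have h3 : f t / (t * deriv f t) ≤ C₁ := by exact_mod_cast hc
    rw [div_le_iff₀ (by positivity)] at h3
    calc f t ≤ C₁ * (t * deriv f t) := h3
      _ ≤ max (max C₁ C₂) 1 * (t * deriv f t) := by
        gcongr
        exact (le_max_left _ _).trans (le_max_left _ _)
      _ = _ := by ring
  · have h3 : deriv f s / deriv f t ≤ C₂ := by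
      exact_mod_cast (le_iSup₂ (f := fun s (_ : s ≥ t) =>
        ((deriv f s / deriv f t : ℝ) : EReal)) s hs).trans hd
    rw [div_le_iff₀ hb] at h3
    refine h3.trans ?_
    gcongr
    exact (le_max_right _ _).trans (le_max_left _ _)

variable {f : ℝ → ℝ} {C t₁ : ℝ}

lemma le_sub_of_le_deriv (hd : ∀ t ≥ t₁, 0 < deriv f t) {a b m : ℝ} (ha : t₁ ≤ a)
    (hab : a ≤ b) (hm : ∀ t, a ≤ t → t ≤ b → m ≤ deriv f t) : m * (b - a) ≤ f b - f a := by
  -- `deriv` is zero wherever `f` is not differentiable, so positivity gives differentiability.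
  have hdiff : ∀ t ≥ t₁, DifferentiableAt ℝ f t := fun t ht =>
    differentiableAt_of_deriv_ne_zero (hd t ht).ne'
  refine (convex_Icc a b).mul_sub_le_image_sub_of_le_deriv
    (fun t ht => (hdiff t (ha.trans ht.1)).continuousAt.continuousWithinAt)
    (fun t ht => ?_) (fun t ht => ?_) a ⟨le_rfl, hab⟩ b ⟨hab, le_rfl⟩ hab
  · rw [interior_Icc] at ht
    exact (hdiff t (ha.trans ht.1.le)).differentiableWithinAt
  · rw [interior_Icc] at ht
    exact hm t ht.1.le ht.2.le

lemma sub_le_of_deriv_le (hd : ∀ t ≥ t₁, 0 < deriv f t) {a b m : ℝ} (ha : t₁ ≤ a)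
    (hab : a ≤ b) (hm : ∀ t, a ≤ t → t ≤ b → deriv f t ≤ m) : f b - f a ≤ m * (b - a) := by
  have hdiff : ∀ t ≥ t₁, DifferentiableAt ℝ f t := fun t ht =>
    differentiableAt_of_deriv_ne_zero (hd t ht).ne'
  refine (convex_Icc a b).image_sub_le_mul_sub_of_deriv_le
    (fun t ht => (hdiff t (ha.trans ht.1)).continuousAt.continuousWithinAt)
    (fun t ht => ?_) (fun t ht => ?_) a ⟨le_rfl, hab⟩ b ⟨hab, le_rfl⟩ hab
  · rw [interior_Icc] at ht
    exact (hdiff t (ha.trans ht.1.le)).differentiableWithinAt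
  · rw [interior_Icc] at ht
    exact hm t ht.1.le ht.2.le

lemma le_of_deriv_pos (hd : ∀ t ≥ t₁, 0 < deriv f t) {a b : ℝ} (ha : t₁ ≤ a) (hab : a ≤ b) :
    f a ≤ f b := by
  have := le_sub_of_le_deriv hd ha hab (m := 0) fun t hat _ => (hd t (ha.trans hat)).le
  linarith

/-- Since `f' t ≥ f t / (C t) ≥ f t₁ / (C t)`, the function `f` grows at least like a multiple of
`log`. -/
lemma tendsto_atTop_of_le_mul_deriv (hC : 0 < C) (ht₁ : 1 ≤ t₁) (hpos : ∀ t ≥ t₁, 0 < f t)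
    (hd : ∀ t ≥ t₁, 0 < deriv f t) (hle : ∀ t ≥ t₁, f t ≤ C * t * deriv f t) :
    Tendsto f atTop atTop := by
  set κ := f t₁ / C with hκ
  have hκ0 : 0 < κ := div_pos (hpos t₁ le_rfl) hC
  have hlog : Tendsto (fun t => f t₁ - κ * Real.log t₁ + κ * Real.log t) atTop atTop :=
    tendsto_atTop_add_const_left _ _ (Real.tendsto_log_atTop.const_mul_atTop hκ0)
  refine tendsto_atTop_mono' _ ?_ hlog
  filter_upwards [eventually_ge_atTop t₁] with t ht
  have hdiff : ∀ s ≥ t₁, HasDerivAt (fun s => f s - κ * Real.log s) (deriv f s - κ * s⁻¹) s :=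
    fun s hs => (differentiableAt_of_deriv_ne_zero (hd s hs).ne').hasDerivAt.sub
      ((Real.hasDerivAt_log (by linarith)).const_mul κ)
  have hmono : MonotoneOn (fun s => f s - κ * Real.log s) (Set.Ici t₁) := by
    refine monotoneOn_of_deriv_nonneg (convex_Ici t₁)
      (fun s hs => (hdiff s hs).continuousAt.continuousWithinAt) (fun s hs => ?_) fun s hs => ?_
    · rw [interior_Ici] at hs
      exact (hdiff s hs.le).differentiableAt.differentiableWithinAt
    · rw [interior_Ici] at hs
      have hs' : t₁ ≤ s := le_of_lt hs
      have hspos : 0 < s := by linarith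
      rw [(hdiff s hs').deriv, sub_nonneg, hκ, ← div_eq_mul_inv, div_div, div_le_iff₀ (by positivity)]
      linarith [hle s hs', le_of_deriv_pos hd le_rfl hs']
  have := hmono (Set.mem_Ici.2 le_rfl) (Set.mem_Ici.2 ht) ht
  simp only at this
  linarith

/-- The counted integers lie between two points where `f` differs by less than `2 r + 1`, while its
slope there is at least `f' N / C`. -/
lemma card_floor_near_le (hC : 0 < C) (hd : ∀ t ≥ t₁, 0 < deriv f t)
    (hdle : ∀ t ≥ t₁, ∀ s ≥ t, deriv f s ≤ C * deriv f t) {n₁ N : ℕ} (hn₁ : t₁ ≤ n₁)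
    (hN : n₁ ≤ N) {r : ℤ} (hr : 0 ≤ r) (p : ℤ) :
    (((Finset.Icc n₁ N).filter fun n : ℕ => |⌊f n⌋ - p| ≤ r).card : ℝ) ≤
      1 + (2 * r + 1) * C / deriv f N := by
  have hN' : t₁ ≤ (N : ℝ) := hn₁.trans (by exact_mod_cast hN)
  have hdN := hd N hN'
  have hr' : (0 : ℝ) ≤ r := by exact_mod_cast hr
  set S := (Finset.Icc n₁ N).filter fun n : ℕ => |⌊f n⌋ - p| ≤ r with hS
  rcases S.eq_empty_or_nonempty with he | hne
  · rw [he]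
    simp only [Finset.card_empty, Nat.cast_zero]
    positivity
  have ha := S.min'_mem hne
  have hb := S.max'_mem hne
  set a := S.min' hne
  set b := S.max' hne
  have hab : a ≤ b := S.min'_le_max' hne
  have hcard : S.card ≤ b - a + 1 := by
    have hsub : S ⊆ Finset.Icc a b := fun n hn =>
      Finset.mem_Icc.2 ⟨S.min'_le n hn, S.le_max' n hn⟩
    have := Finset.card_le_card hsub
    rw [Nat.card_Icc] at this
    omega
  have hcard' : (S.card : ℝ) ≤ b - a + 1 := by
    have : (S.card : ℝ) ≤ ((b - a + 1 : ℕ) : ℝ) := by exact_mod_cast hcard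
    rwa [Nat.cast_add, Nat.cast_sub hab, Nat.cast_one] at this
  rw [hS, Finset.mem_filter, Finset.mem_Icc, abs_le] at ha hb
  have hta : t₁ ≤ (a : ℝ) := hn₁.trans (by exact_mod_cast ha.1.1)
  have hab' : (a : ℝ) ≤ b := by exact_mod_cast hab
  have hbN : (b : ℝ) ≤ N := by exact_mod_cast hb.1.2
  have hinc := le_sub_of_le_deriv hd hta hab' (m := deriv f N / C) fun t h1 h2 => by
    rw [div_le_iff₀ hC, mul_comm]
    exact hdle t (hta.trans h1) N (h2.trans hbN)
  have hfb : f b < p + r + 1 := by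
    have h1 := Int.lt_floor_add_one (f b)
    have h2 : (⌊f b⌋ : ℝ) ≤ p + r := by exact_mod_cast (by linarith [hb.2.2] : ⌊f b⌋ ≤ p + r)
    linarith
  have hfa : (p : ℝ) - r ≤ f a := by
    have h1 := Int.floor_le (f a)
    have h2 : (p : ℝ) - r ≤ ⌊f a⌋ := by exact_mod_cast (by linarith [ha.2.1] : p - r ≤ ⌊f a⌋)
    linarith
  have h3 : (b - a : ℝ) ≤ (2 * r + 1) * C / deriv f N := by
    rw [le_div_iff₀ hdN]
    have h4 : deriv f N / C * (b - a) ≤ 2 * r + 1 := by linarith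
    rw [div_mul_eq_mul_div, div_le_iff₀ hC] at h4
    linarith
  linarith

lemma sum_comp_le_mul_sum {F : Finset ℕ} {e : ℕ → ℕ} {P : ℕ} (he : ∀ n ∈ F, e n < P) {L : ℝ}
    (hL : ∀ p, ((F.filter fun n => e n = p).card : ℝ) ≤ L) {w : ℕ → ℝ} (hw : ∀ p, 0 ≤ w p) :
    ∑ n ∈ F, w (e n) ≤ L * ∑ p ∈ Finset.range P, w p := by
  rw [← Finset.sum_fiberwise_of_maps_to (fun n hn => Finset.mem_range.2 (he n hn)), Finset.mul_sum]
  refine Finset.sum_le_sum fun p _ => ?_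
  calc ∑ n ∈ F with e n = p, w (e n) = ∑ n ∈ F with e n = p, w p :=
        Finset.sum_congr rfl fun n hn => by rw [(Finset.mem_filter.1 hn).2]
    _ = (F.filter fun n => e n = p).card * w p := by rw [Finset.sum_const, nsmul_eq_mul]
    _ ≤ L * w p := mul_le_mul_of_nonneg_right (hL p) (hw p)

end Counting

/-! ### Averages along the sequence of exponents. -/

section Main

variable {X : Type*} [NormedAddCommGroup X] [NormedSpace ℂ X]

lemma norm_powerAlong_apply_le {T : X →L[ℂ] X} {M : ℝ} (hM : ∀ n : ℕ, ‖T ^ n‖ ≤ M) (t₀ : ℝ)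
    (f : ℝ → ℝ) (h : ℕ → ℤ) (n : ℕ) (x : X) : ‖powerAlong T t₀ f h n x‖ ≤ M * ‖x‖ := by
  unfold powerAlong
  split_ifs
  · exact (T ^ _).le_of_opNorm_le (hM _) x
  · exact ContinuousLinearMap.le_of_opNorm_le _ (hM 0) x

lemma norm_dual_powerAlong_apply_le {T : X →L[ℂ] X} {M : ℝ} (hM : ∀ n : ℕ, ‖T ^ n‖ ≤ M) (t₀ : ℝ)
    (f : ℝ → ℝ) (h : ℕ → ℤ) (n : ℕ) (x : X) {φ : X →L[ℂ] ℂ} (hφ : ‖φ‖ ≤ 1) :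
    ‖φ (powerAlong T t₀ f h n x)‖ ≤ M * ‖x‖ := by
  refine (φ.le_of_opNorm_le hφ _).trans ?_
  rw [one_mul]
  exact norm_powerAlong_apply_le hM t₀ f h n x

/-- The sums of `|φ (T ^ ([f n] + h n) x)|` over `n ≤ N` are `o(N)`, uniformly in the dual unit
ball. -/
lemma eventually_sum_powerAlong_le [CompleteSpace X] {T : X →L[ℂ] X}
    (hT : RelWeaklyCompactOrbits T)
    (hσ : ∀ c : ℂ, ‖c‖ = 1 → ¬ Module.End.HasEigenvalue (T : X →ₗ[ℂ] X) c) (x : X) (t₀ : ℝ)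
    {f : ℝ → ℝ} (hf : IsClassP 1 f) {h : ℕ → ℤ} {r : ℤ} (hh : ∀ n, |h n| ≤ r)
    {ε : ℝ} (hε : 0 < ε) :
    ∀ᶠ N : ℕ in atTop, ∀ φ : X →L[ℂ] ℂ, ‖φ‖ ≤ 1 →
      ∑ n ∈ Finset.Icc 1 N, ‖φ (powerAlong T t₀ f h n x)‖ ≤ ε * N := by
  obtain ⟨M, hM⟩ := exists_norm_pow_le hT
  obtain ⟨C, t₁, hC, ht₁, hb⟩ := hf.exists_bounds
  have hd : ∀ t ≥ t₁, 0 < deriv f t := fun t ht => (hb t ht).2.1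
  have hdle : ∀ t ≥ t₁, ∀ s ≥ t, deriv f s ≤ C * deriv f t := fun t ht => (hb t ht).2.2.2
  have htop := tendsto_atTop_of_le_mul_deriv hC ht₁ (fun t ht => (hb t ht).1) hd
    fun t ht => (hb t ht).2.2.1
  have htop' : Tendsto (fun n : ℕ => f n) atTop atTop := htop.comp tendsto_natCast_atTop_atTop
  have hr : 0 ≤ r := (abs_nonneg _).trans (hh 0)
  have hr' : (0 : ℝ) ≤ r := by exact_mod_cast hr
  obtain ⟨n₁, hn₁⟩ := eventually_atTop.1 ((htop'.eventually_ge_atTop ((r : ℝ) + 1)).and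
    ((eventually_ge_atTop (max t₁ t₀)).natCast_atTop))
  have hfn : ∀ n ≥ n₁, (r : ℝ) + 1 ≤ f n := fun n hn => (hn₁ n hn).1
  have htn : ∀ n ≥ n₁, t₁ ≤ (n : ℝ) := fun n hn => (le_max_left _ _).trans (hn₁ n hn).2
  have ht0n : ∀ n ≥ n₁, t₀ ≤ (n : ℝ) := fun n hn => (le_max_right _ _).trans (hn₁ n hn).2
  -- Chosen so that `f N ≤ D * N`, since the slope beyond `n₁` is at most `C * deriv f n₁`.
  set D := f n₁ + C * deriv f n₁ with hD
  have hD0 : 0 ≤ D := by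
    have := (hb n₁ (htn n₁ le_rfl)).1
    have := hd n₁ (htn n₁ le_rfl)
    positivity
  -- The first term absorbs `2 * f N`, the second the contribution of `f N / f' N ≤ C * N`.
  set R := 2 * D + 2 * (2 * r + 1) * C ^ 2 + 1 with hR
  have hR0 : 0 < R := by positivity
  obtain ⟨N₀, hN₀⟩ := uniform_average_small hM hσ (hT x) (ε := ε / 2 / R) (by positivity)
  have hsmall : Tendsto (fun N : ℕ => ε / 2 * (N : ℝ)) atTop atTop :=
    tendsto_natCast_atTop_atTop.const_mul_atTop (by positivity)
  filter_upwards [eventually_ge_atTop n₁, htop'.eventually_ge_atTop (N₀ : ℝ),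
    hsmall.eventually_ge_atTop (n₁ * (M * ‖x‖)), eventually_ge_atTop 1] with N hN hfN hBN hN1 φ hφ
  -- A strict bound on all exponents up to `N`, and at most `2 * f N` because `f N ≥ r + 1`.
  set P := ⌊f N⌋.toNat + r.toNat + 1 with hP
  have hfNr := hfn N hN
  have hfloor : 0 ≤ ⌊f N⌋ := Int.floor_nonneg.2 (by linarith)
  have hPcast : (P : ℝ) = ⌊f N⌋ + r + 1 := by
    have h1 : (P : ℤ) = ⌊f N⌋ + r + 1 := by
      rw [hP]
      push_cast
      rw [Int.toNat_of_nonneg hfloor, Int.toNat_of_nonneg hr]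
    exact_mod_cast h1
  have hPle : (P : ℝ) ≤ 2 * f N := by
    rw [hPcast]
    linarith [Int.floor_le (f N)]
  have hPN₀ : N₀ ≤ P := by
    have : (N₀ : ℝ) ≤ P := by
      rw [hPcast]
      linarith [Int.lt_floor_add_one (f N)]
    exact_mod_cast this
  have hsum := hN₀ P hPN₀ φ hφ
  set e : ℕ → ℕ := fun n => (⌊f n⌋ + h n).toNat with he
  have hexp : ∀ n ≥ n₁, 0 ≤ ⌊f n⌋ + h n := by
    intro n hn
    have h1 : r ≤ ⌊f n⌋ := Int.le_floor.2 (by linarith [hfn n hn])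
    linarith [(abs_le.1 (hh n)).1]
  have hpow : ∀ n ∈ Finset.Icc n₁ N, powerAlong T t₀ f h n x = (T ^ e n) x := by
    intro n hn
    have hn' := (Finset.mem_Icc.1 hn).1
    unfold powerAlong
    rw [if_pos ⟨ht0n n hn', hexp n hn'⟩]
  have heP : ∀ n ∈ Finset.Icc n₁ N, e n < P := by
    intro n hn
    obtain ⟨hn', hnN⟩ := Finset.mem_Icc.1 hn
    have h1 : ⌊f n⌋ ≤ ⌊f N⌋ := Int.floor_mono
      (le_of_deriv_pos hd (htn n hn') (by exact_mod_cast hnN))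
    have h2 := (abs_le.1 (hh n)).2
    simp only [he, hP]
    omega
  have hfib : ∀ p : ℕ, (((Finset.Icc n₁ N).filter fun n => e n = p).card : ℝ) ≤
      1 + (2 * r + 1) * C / deriv f N := by
    intro p
    refine le_trans ?_ (card_floor_near_le hC hd hdle (htn n₁ le_rfl) hN hr p)
    norm_cast
    refine Finset.card_le_card fun n hn => ?_
    rw [Finset.mem_filter] at hn ⊢
    refine ⟨hn.1, ?_⟩
    have h1 := hexp n (Finset.mem_Icc.1 hn.1).1
    have h2 : ((⌊f n⌋ + h n).toNat : ℤ) = p := by exact_mod_cast hn.2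
    rw [Int.toNat_of_nonneg h1] at h2
    rw [← h2, show ⌊f n⌋ - (⌊f n⌋ + h n) = -h n by ring, abs_neg]
    exact hh n
  have hNpos : (0 : ℝ) < N := by exact_mod_cast hN1
  have hfD : f N ≤ D * N := by
    have h1 := sub_le_of_deriv_le hd (htn n₁ le_rfl) (by exact_mod_cast hN : (n₁ : ℝ) ≤ N)
      (m := C * deriv f n₁) fun t h1 _ => hdle n₁ (htn n₁ le_rfl) t h1
    have h2 := hd n₁ (htn n₁ le_rfl)
    have h3 := (hb n₁ (htn n₁ le_rfl)).1
    have h4 : (1 : ℝ) ≤ N := by exact_mod_cast hN1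
    have h5 : 0 ≤ C * deriv f n₁ * n₁ := by positivity
    rw [hD]
    nlinarith
  have hdN := hd N (htn N hN)
  have hlate : ∑ n ∈ Finset.Icc n₁ N, ‖φ (powerAlong T t₀ f h n x)‖ ≤ ε / 2 * N := by
    calc ∑ n ∈ Finset.Icc n₁ N, ‖φ (powerAlong T t₀ f h n x)‖
        = ∑ n ∈ Finset.Icc n₁ N, ‖φ ((T ^ e n) x)‖ :=
          Finset.sum_congr rfl fun n hn => by rw [hpow n hn]
      _ ≤ (1 + (2 * r + 1) * C / deriv f N) * ∑ p ∈ Finset.range P, ‖φ ((T ^ p) x)‖ :=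
          sum_comp_le_mul_sum heP hfib (w := fun p => ‖φ ((T ^ p) x)‖) fun p => norm_nonneg _
      _ ≤ (1 + (2 * r + 1) * C / deriv f N) * (ε / 2 / R * (2 * f N)) := by
          gcongr
          exact hsum.trans (by gcongr)
      _ = ε / 2 / R * (2 * f N + 2 * (2 * r + 1) * C * (f N / deriv f N)) := by ring
      _ ≤ ε / 2 / R * (2 * (D * N) + 2 * (2 * r + 1) * C * (C * N)) := by
          gcongr
          rw [div_le_iff₀ hdN]
          exact (hb N (htn N hN)).2.2.1
      _ ≤ ε / 2 / R * (R * N) := by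
          gcongr
          rw [hR]
          nlinarith
      _ = ε / 2 * N := by field_simp
  have hearly : ∑ n ∈ Finset.range n₁, ‖φ (powerAlong T t₀ f h n x)‖ ≤ n₁ * (M * ‖x‖) := by
    refine (Finset.sum_le_sum fun n _ => norm_dual_powerAlong_apply_le hM t₀ f h n x hφ).trans ?_
    simp
  have hsub : Finset.Icc 1 N ⊆ Finset.range n₁ ∪ Finset.Icc n₁ N := by
    intro n hn
    simp only [Finset.mem_union, Finset.mem_range, Finset.mem_Icc] at hn ⊢
    omega
  have hdisj : Disjoint (Finset.range n₁) (Finset.Icc n₁ N) := by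
    rw [Finset.disjoint_left]
    intro n hn hn'
    simp only [Finset.mem_range, Finset.mem_Icc] at hn hn'
    omega
  calc ∑ n ∈ Finset.Icc 1 N, ‖φ (powerAlong T t₀ f h n x)‖
      ≤ ∑ n ∈ Finset.range n₁ ∪ Finset.Icc n₁ N, ‖φ (powerAlong T t₀ f h n x)‖ :=
        Finset.sum_le_sum_of_subset_of_nonneg hsub fun _ _ _ => norm_nonneg _
    _ = _ := Finset.sum_union hdisj
    _ ≤ ε * N := by linarith

lemma HasPositiveDensity.exists_eventually_le_card {A : Set ℕ} (hA : HasPositiveDensity A) :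
    ∃ d : ℝ, 0 < d ∧ ∀ᶠ N : ℕ in atTop, d * N ≤ (upTo A N).card := by
  obtain ⟨d, hd, hlim⟩ := hA
  refine ⟨d / 2, by positivity, ?_⟩
  filter_upwards [hlim.eventually (lt_mem_nhds (half_lt_self hd)), eventually_gt_atTop 0]
    with N hN hpos
  have : (0 : ℝ) < N := by exact_mod_cast hpos
  exact ((lt_div_iff₀ this).1 hN).le

lemma absAverage_le {T : X →L[ℂ] X} {M : ℝ} (hM : ∀ n : ℕ, ‖T ^ n‖ ≤ M) (t₀ : ℝ)
    (f : ℝ → ℝ) (h : ℕ → ℤ) (A : Set ℕ) (x : X) (N : ℕ) {φ : X →L[ℂ] ℂ} (hφ : ‖φ‖ ≤ 1) :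
    absAverage T t₀ f h A x N φ ≤ M * ‖x‖ := by
  have hM0 : 0 ≤ M := (norm_nonneg _).trans (hM 0)
  have h1 : ∑ n ∈ upTo A N, ‖φ (powerAlong T t₀ f h n x)‖ ≤ (upTo A N).card * (M * ‖x‖) := by
    refine (Finset.sum_le_sum fun n _ => norm_dual_powerAlong_apply_le hM t₀ f h n x hφ).trans ?_
    simp
  unfold absAverage
  rcases Nat.eq_zero_or_pos (upTo A N).card with h0 | h0
  · rw [h0]
    simp only [Nat.cast_zero, inv_zero, zero_mul]
    positivity
  · have : (0 : ℝ) < (upTo A N).card := by exact_mod_cast h0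
    rwa [inv_mul_eq_div, div_le_iff₀ this, mul_comm (M * ‖x‖)]

lemma absAverage_nonneg (T : X →L[ℂ] X) (t₀ : ℝ) (f : ℝ → ℝ) (h : ℕ → ℤ) (A : Set ℕ) (x : X)
    (N : ℕ) (φ : X →L[ℂ] ℂ) : 0 ≤ absAverage T t₀ f h A x N φ := by
  unfold absAverage
  positivity

lemma norm_dual_average_le (T : X →L[ℂ] X) (t₀ : ℝ) (f : ℝ → ℝ) (h : ℕ → ℤ) (A : Set ℕ) (x : X)
    (N : ℕ) (φ : X →L[ℂ] ℂ) :
    ‖φ (average T t₀ f h A x N)‖ ≤ absAverage T t₀ f h A x N φ := by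
  unfold average absAverage
  rw [map_smul, norm_smul, map_sum, norm_inv, Complex.norm_natCast]
  gcongr
  exact norm_sum_le _ _

end Main

end SubseqErgodic

end

open SubseqErgodic in
theorem theorem2p7 {X : Type*} [NormedAddCommGroup X] [NormedSpace ℂ X] [CompleteSpace X]
    (T : X →L[ℂ] X) (hT : RelWeaklyCompactOrbits T)
    (hσ : ∀ c : ℂ, ‖c‖ = 1 → ¬ Module.End.HasEigenvalue (T : X →ₗ[ℂ] X) c)
    (x : X)
    (t₀ : ℝ) (f : ℝ → ℝ) (hcont : ContinuousOn f (Set.Ici t₀)) (hf : IsClassP 1 f)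
    (h : ℕ → ℤ) (hh : ∃ r : ℤ, ∀ n, |h n| ≤ r)
    (A : Set ℕ) (hA : HasPositiveDensity A) :
    (∀ N : ℕ, BddAbove (Set.range fun φ : {φ : X →L[ℂ] ℂ // ‖φ‖ = 1} =>
        absAverage T t₀ f h A x N φ)) ∧
    Tendsto (fun N : ℕ => ⨆ φ : {φ : X →L[ℂ] ℂ // ‖φ‖ = 1}, absAverage T t₀ f h A x N φ)
      atTop (𝓝 0) ∧
    Tendsto (fun N : ℕ => average T t₀ f h A x N) atTop (𝓝 0) := by
  obtain ⟨r, hr⟩ := hh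
  obtain ⟨M, hM⟩ := exists_norm_pow_le hT
  obtain ⟨d, hd, hcard⟩ := hA.exists_eventually_le_card
  have hsmall : ∀ ε > 0, ∀ᶠ N : ℕ in atTop, ∀ φ : X →L[ℂ] ℂ, ‖φ‖ ≤ 1 →
      absAverage T t₀ f h A x N φ ≤ ε := by
    intro ε hε
    -- The factor `d` pays for enlarging the sum from `A ∩ [1, N]` to `[1, N]`.
    filter_upwards [eventually_sum_powerAlong_le hT hσ x t₀ hf hr (ε := ε * d) (by positivity),
      hcard, eventually_gt_atTop 0] with N hN hcN hN0 φ hφ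
    have hNpos : (0 : ℝ) < N := by exact_mod_cast hN0
    have hcpos : (0 : ℝ) < (upTo A N).card := lt_of_lt_of_le (by positivity) hcN
    unfold absAverage
    rw [inv_mul_eq_div, div_le_iff₀ hcpos]
    calc ∑ n ∈ upTo A N, ‖φ (powerAlong T t₀ f h n x)‖
        ≤ ∑ n ∈ Finset.Icc 1 N, ‖φ (powerAlong T t₀ f h n x)‖ :=
          Finset.sum_le_sum_of_subset_of_nonneg (by
            classical
            unfold upTo
            exact Finset.filter_subset _ _)
            fun _ _ _ => norm_nonneg _
      _ ≤ ε * d * N := hN φ hφ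
      _ = ε * (d * N) := by ring
      _ ≤ ε * (upTo A N).card := by gcongr
  refine ⟨fun N => ⟨M * ‖x‖, ?_⟩, ?_, ?_⟩
  -- Boundedness matters: a real `⨆` over an unbounded family defaults to `0`.
  · rintro _ ⟨φ, rfl⟩
    exact absAverage_le hM t₀ f h A x N φ.2.le
  · rw [Metric.tendsto_nhds]
    intro ε hε
    filter_upwards [hsmall (ε / 2) (by positivity)] with N hN
    have h0 : 0 ≤ ⨆ φ : {φ : X →L[ℂ] ℂ // ‖φ‖ = 1}, absAverage T t₀ f h A x N φ :=
      Real.iSup_nonneg fun φ => absAverage_nonneg T t₀ f h A x N φ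
    rw [dist_zero_right, Real.norm_of_nonneg h0]
    -- `Real.iSup_le` also covers `X = 0`, where no functional has norm one and the supremum is `0`.
    exact (Real.iSup_le (fun φ : {φ : X →L[ℂ] ℂ // ‖φ‖ = 1} => hN φ φ.2.le)
      (by positivity)).trans_lt (half_lt_self hε)
  · rw [Metric.tendsto_nhds]
    intro ε hε
    filter_upwards [hsmall (ε / 2) (by positivity)] with N hN
    obtain ⟨φ, hφ, hφa⟩ := exists_dual_vector'' ℂ (average T t₀ f h A x N)
    have h1 := (norm_dual_average_le T t₀ f h A x N φ).trans (hN φ hφ)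
    rw [hφa] at h1
    rw [dist_zero_right]
    have h2 : ‖average T t₀ f h A x N‖ ≤ ε / 2 := by simpa using h1
    linarith
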